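/- Let $N\ge 1$, $s\in(0,1)$ and let $\Omega\subset\mathbb R^N$ be open and bounded. For a measurable function $u:\mathbb R^N\to\mathbb R$ set $$[u]_{W^{s,1}(\mathbb R^N)}=\int_{\mathbb R^N}\int_{\mathbb R^N}\frac{|u(x)-u(y)|}{|x-y|^{N+s}}\,dx\,dy\in[0,\infty],$$ for a measurable set $E\subset\mathbb R^N$ let $P_s(E)=[1_E]_{W^{s,1}(\mathbb R^N)}$ be its $s$-perimeter, and let $$h_s(\Omega)=\inf\left\{\frac{P_s(E)}{|E|}\,:\,E\subset\Omega \text{ measurable},\ |E|>0\right\}$$ be the $s$-Cheeger constant of $\Omega$; an $s$-Cheeger set of $\Omega$ is a measurable set $E\subset\Omega$ with $|E|>0$ attaining this infimum. Let $$\mathcal W^{s,1}_0(\Omega)=\{u\in L^1(\Omega)\,:\,[u]_{W^{s,1}(\mathbb R^N)}<\infty,\ u=0\text{ a.e. in }\mathbb R^N\setminus\Omega\},$$ let $\widetilde W^{s,1}_0(\Omega)\subset\mathcal W^{s,1}_0(\Omega)$ be the closure of $C^\infty_0(\Omega)$ with respect to the norm $[u]_{W^{s,1}(\mathbb R^N)}+\|u\|_{L^1(\Omega)}$,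 and let $$\lambda^s_{1,1}(\Omega)=\inf\{[u]_{W^{s,1}(\mathbb R^N)}\,:\,u\in\widetilde W^{s,1}_0(\Omega),\ \|u\|_{L^1(\Omega)}=1,\ u\ge 0\}.$$ (Infima over the empty set are $+\infty$.) (1) For every $u\in\mathcal W^{s,1}_0(\Omega)\setminus\{0\}$, $$\frac{[u]_{W^{s,1}(\mathbb R^N)}}{\|u\|_{L^1(\Omega)}}\ge h_s(\Omega).$$ (2) If equality holds in (1) for such a $u$, then for almost every $t>0$ each of the level sets $\{x\in\Omega:|u(x)|>t\}$, $\{x\in\Omega:u(x)>t\}$ and $\{x\in\Omega:u(x)<-t\}$ that has positive $N$-dimensional Lebesgue measure is an $s$-Cheeger set of $\Omega$. (3) If $\Omega$ has Lipschitz boundary (that is, near each of its boundary points, $\Omega$ coincides, in suitable orthonormal coordinates, with the strict epigraph of a Lipschitz function), then $\lambda^s_{1,1}(\Omega)=h_s(\Omega)$. -/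

import Mathlib

open MeasureTheory Set
open scoped ENNReal ContDiff

namespace FractionalCheeger

/-- The `(s,1)` Gagliardo seminorm on `ℝ^N`, with values in `[0, ∞]`:
`[u] = ∫∫ |u(x) - u(y)| / |x - y|^(N+s) dx dy`. -/
noncomputable def gagliardo {N : ℕ} (s : ℝ) (u : EuclideanSpace ℝ (Fin N) → ℝ) : ℝ≥0∞ :=
  ∫⁻ x, ∫⁻ y, ENNReal.ofReal (|u x - u y| / ‖x - y‖ ^ ((N : ℝ) + s))

/-- The nonlocal `s`-perimeter of a set: the Gagliardo seminorm of its characteristic function. -/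
noncomputable def perimeter {N : ℕ} (s : ℝ) (A : Set (EuclideanSpace ℝ (Fin N))) : ℝ≥0∞ :=
  gagliardo s (A.indicator fun _ => (1 : ℝ))

/-- The competitors in the Cheeger problem: Lebesgue measurable subsets of `Ω` of positive
measure, so that the quotient `P_s(E) / |E|` makes sense. -/
def IsAdmissible {N : ℕ} (Ω E : Set (EuclideanSpace ℝ (Fin N))) : Prop :=
  E ⊆ Ω ∧ NullMeasurableSet E volume ∧ volume E ≠ 0

/-- The `s`-Cheeger constant `h_s(Ω) = inf_{E ⊆ Ω} P_s(E) / |E|`. -/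
noncomputable def cheegerConstant {N : ℕ} (s : ℝ) (Ω : Set (EuclideanSpace ℝ (Fin N))) : ℝ≥0∞ :=
  ⨅ (E : Set (EuclideanSpace ℝ (Fin N))) (_ : IsAdmissible Ω E), perimeter s E / volume E

/-- `E` is an `s`-Cheeger set of `Ω`: it attains the infimum defining `h_s(Ω)`. -/
def IsCheegerSet {N : ℕ} (s : ℝ) (Ω E : Set (EuclideanSpace ℝ (Fin N))) : Prop :=
  IsAdmissible Ω E ∧ perimeter s E / volume E = cheegerConstant s Ω

/-- The space `𝒲^{s,1}_0(Ω)`: functions on `ℝ^N` in `L¹(Ω)`, with finite Gagliardo seminorm on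
`ℝ^N`, vanishing almost everywhere outside `Ω`. Elements are functions modulo a.e. equality; all
the notions used below are invariant under a.e. equality. -/
def MemCalW {N : ℕ} (s : ℝ) (Ω : Set (EuclideanSpace ℝ (Fin N)))
    (u : EuclideanSpace ℝ (Fin N) → ℝ) : Prop :=
  IntegrableOn u Ω volume ∧ gagliardo s u < ⊤ ∧ ∀ᵐ x ∂volume, x ∉ Ω → u x = 0

/-- `φ ∈ C^∞_0(Ω)`: smooth with compact support contained in `Ω` (extended by zero to `ℝ^N`). -/
def IsTestFunction {N : ℕ} (Ω : Set (EuclideanSpace ℝ (Fin N)))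
    (φ : EuclideanSpace ℝ (Fin N) → ℝ) : Prop :=
  ContDiff ℝ ∞ φ ∧ HasCompactSupport φ ∧ tsupport φ ⊆ Ω

/-- The space `W̃^{s,1}_0(Ω)`: the closure of `C^∞_0(Ω)` (inside `𝒲^{s,1}_0(Ω)`) with respect to
the norm `[u]_{W^{s,1}(ℝ^N)} + ‖u‖_{L¹(Ω)}`. -/
def MemTildeW {N : ℕ} (s : ℝ) (Ω : Set (EuclideanSpace ℝ (Fin N)))
    (u : EuclideanSpace ℝ (Fin N) → ℝ) : Prop :=
  MemCalW s Ω u ∧ ∀ ε : ℝ≥0∞, 0 < ε → ∃ φ : EuclideanSpace ℝ (Fin N) → ℝ,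
    IsTestFunction Ω φ ∧
      gagliardo s (fun x => φ x - u x) +
        eLpNorm (fun x => φ x - u x) 1 (volume.restrict Ω) < ε

/-- `λ^s_{1,1}(Ω) = inf { [u] : u ∈ W̃^{s,1}_0(Ω), ‖u‖_{L¹(Ω)} = 1, u ≥ 0 }`. -/
noncomputable def firstEigenvalue {N : ℕ} (s : ℝ) (Ω : Set (EuclideanSpace ℝ (Fin N))) : ℝ≥0∞ :=
  ⨅ (u : EuclideanSpace ℝ (Fin N) → ℝ)
    (_ : MemTildeW s Ω u ∧ eLpNorm u 1 (volume.restrict Ω) = 1 ∧ ∀ᵐ x ∂volume, 0 ≤ u x),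
    gagliardo s u

/-- `Ω` has Lipschitz boundary: near each boundary point, and in a suitable orthonormal frame whose
last vector is `e`, the set `Ω` is the strict epigraph, in the direction `e`, of a Lipschitz
function `γ` of the components orthogonal to `e`. -/
def HasLipschitzBoundary {N : ℕ} (Ω : Set (EuclideanSpace ℝ (Fin N))) : Prop :=
  ∀ x ∈ frontier Ω, ∃ (r : ℝ) (e : EuclideanSpace ℝ (Fin N)) (K : NNReal)
    (γ : (Submodule.span ℝ {e})ᗮ → ℝ),
    0 < r ∧ ‖e‖ = 1 ∧ LipschitzWith K γ ∧
      ∀ y ∈ Metric.ball x r,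
        (y ∈ Ω ↔ γ ((Submodule.span ℝ {e})ᗮ.orthogonalProjectionOnto y) < inner ℝ e y)

end FractionalCheeger

namespace FractionalCheeger

/-! Everything rests on a coarea formula, `gagliardo_eq_lintegral_perimeter`: for `w ≥ 0`, `[w]` is
the integral over `t > 0` of `P_s({w > t})`, while the layer-cake formula writes `∫ w` as the
integral of `|{w > t}|`. Each superlevel set lies in `Ω` up to a null set, so `h_s |{w > t}| ≤
P_s({w > t})`. Integrating in `t`, with `w = |u|` and `[|u|] ≤ [u]`, gives the Cheeger inequality.
If it is an equality, the integrands agree for a.e. `t`, which makes the level sets Cheeger sets.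
For the signed level sets one uses that both `[u]` and the norm split exactly over the positive and
negative parts, so both parts attain equality.

The inequality `h_s ≤ λ` follows at once. For `λ ≤ h_s`, the indicator of a competitor must be
approximated by test functions. It is multiplied by a cut-off `η` vanishing near `∂Ω` and equal to 1
off a layer of width `2δ`, then mollified, which preserves the integral and does not increase the
seminorm (`gagliardo_convolution_le`). The cut-off costs at most the layer's measure, `O(δ)` for a
Lipschitz boundary (`HasLipschitzBoundary.hasThinLayer`), times a kernel integral `O(δ^(-s))`
(`exists_lintegral_truncated_kernel_le`). Since `s < 1`, the error `O(δ^(1-s))` vanishes as `δ → 0`.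
-/

variable {N : ℕ} {s : ℝ} {Ω : Set (EuclideanSpace ℝ (Fin N))}

/-! ### Elementary properties of the Gagliardo seminorm -/

/-- The kernel `|x - y|^{-(N+s)}` of the Gagliardo seminorm. -/
noncomputable def kernel (s : ℝ) (x y : EuclideanSpace ℝ (Fin N)) : ℝ≥0∞ :=
  ENNReal.ofReal ((‖x - y‖ ^ ((N : ℝ) + s))⁻¹)

lemma measurable_kernel :
    Measurable fun p : EuclideanSpace ℝ (Fin N) × EuclideanSpace ℝ (Fin N) =>
      kernel s p.1 p.2 := by
  unfold kernel
  fun_prop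

lemma kernel_comm (x y : EuclideanSpace ℝ (Fin N)) : kernel s x y = kernel s y x := by
  simp only [kernel, norm_sub_rev]

lemma ofReal_div_eq_mul_kernel {a : ℝ} (ha : 0 ≤ a) (x y : EuclideanSpace ℝ (Fin N)) :
    ENNReal.ofReal (a / ‖x - y‖ ^ ((N : ℝ) + s)) = ENNReal.ofReal a * kernel s x y := by
  rw [div_eq_mul_inv, ENNReal.ofReal_mul ha, kernel]

lemma gagliardo_eq (u : EuclideanSpace ℝ (Fin N) → ℝ) :
    gagliardo s u = ∫⁻ x, ∫⁻ y, ENNReal.ofReal |u x - u y| * kernel s x y := by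
  simp only [gagliardo, ofReal_div_eq_mul_kernel (abs_nonneg _)]

lemma gagliardo_congr_ae {u v : EuclideanSpace ℝ (Fin N) → ℝ} (h : u =ᵐ[volume] v) :
    gagliardo s u = gagliardo s v := by
  refine lintegral_congr_ae ?_
  filter_upwards [h] with x hx
  refine lintegral_congr_ae ?_
  filter_upwards [h] with y hy
  rw [hx, hy]

lemma perimeter_congr_ae {A B : Set (EuclideanSpace ℝ (Fin N))} (h : A =ᵐ[volume] B) :
    perimeter s A = perimeter s B :=
  gagliardo_congr_ae (indicator_ae_eq_of_ae_eq_set h)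

lemma gagliardo_mono {u v : EuclideanSpace ℝ (Fin N) → ℝ}
    (h : ∀ x y, |u x - u y| ≤ |v x - v y|) : gagliardo s u ≤ gagliardo s v := by
  simp only [gagliardo_eq]
  exact lintegral_mono fun x => lintegral_mono fun y =>
    mul_le_mul_left (ENNReal.ofReal_le_ofReal (h x y)) _

lemma gagliardo_const_mul (c : ℝ) (u : EuclideanSpace ℝ (Fin N) → ℝ) :
    gagliardo s (fun x => c * u x) = ENNReal.ofReal |c| * gagliardo s u := by
  simp only [gagliardo_eq, ← mul_sub, abs_mul, ENNReal.ofReal_mul (abs_nonneg c), mul_assoc,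
    lintegral_const_mul' _ _ ENNReal.ofReal_ne_top]

/-- Pointwise, `|a - b| = |a⁺ - b⁺| + |a⁻ - b⁻|`: as `a⁺` increases and `a⁻` decreases in `a`, the
increments of `a = a⁺ - a⁻` never cancel. -/
lemma gagliardo_eq_posPart_add_negPart {u : EuclideanSpace ℝ (Fin N) → ℝ}
    (hu : AEMeasurable u) :
    gagliardo s u = gagliardo s (fun x => max (u x) 0) + gagliardo s (fun x => max (-u x) 0) := by
  wlog hm : Measurable u generalizing u
  · have h := hu.ae_eq_mk
    rw [gagliardo_congr_ae h, this hu.measurable_mk.aemeasurable hu.measurable_mk]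
    congr 1 <;> refine gagliardo_congr_ae ?_ <;> filter_upwards [h] with x hx <;> rw [hx]
  have hk : Measurable fun p : EuclideanSpace ℝ (Fin N) × EuclideanSpace ℝ (Fin N) =>
      ENNReal.ofReal |max (u p.1) 0 - max (u p.2) 0| * kernel s p.1 p.2 :=
    Measurable.mul (by fun_prop) measurable_kernel
  simp only [gagliardo_eq]
  rw [← lintegral_add_left hk.lintegral_prod_right']
  refine lintegral_congr fun x => ?_
  have hkx : Measurable fun y =>
      ENNReal.ofReal |max (u x) 0 - max (u y) 0| * kernel s x y :=
    hk.comp measurable_prodMk_left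
  refine Eq.trans ?_ (lintegral_add_left hkx _)
  refine lintegral_congr fun y => ?_
  rw [← add_mul, ← ENNReal.ofReal_add (abs_nonneg _) (abs_nonneg _)]
  congr 2
  grind

/-! ### The coarea formula -/

lemma ofReal_abs_sub_eq_lintegral {a b : ℝ} (ha : 0 ≤ a) (hb : 0 ≤ b) :
    ENNReal.ofReal |a - b| = ∫⁻ t in Ioi (0 : ℝ),
      ENNReal.ofReal |(if t < a then (1 : ℝ) else 0) - if t < b then 1 else 0| := by
  have h : ∀ t : ℝ, ENNReal.ofReal |(if t < a then (1 : ℝ) else 0) - if t < b then 1 else 0|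
      = (Ico (min a b) (max a b)).indicator 1 t := by
    intro t
    by_cases h1 : t < a <;> by_cases h2 : t < b <;> simp [h1, h2, indicator]
  simp only [h]
  rw [lintegral_indicator_one measurableSet_Ico, Measure.restrict_apply measurableSet_Ico,
    show |a - b| = max a b - min a b by grind, ← Real.volume_Ico]
  refine measure_congr ?_
  -- The interval between `a` and `b` lies in `[0, ∞)`, so restricting to `t > 0` loses at most the
  -- point `0`.
  have h0 : ∀ᵐ t : ℝ ∂volume, t ≠ 0 := by simp [ae_iff]
  rw [Filter.eventuallyEq_set]
  filter_upwards [h0] with t ht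
  refine ⟨fun hx => ⟨hx, lt_of_le_of_ne ((le_min ha hb).trans hx.1) (Ne.symm ht)⟩,
    fun hx => hx.1⟩

/-- The integrand of `P_s({t < w})`, as a function of the level and of the two points. -/
noncomputable def levelIntegrand (s : ℝ) (w : EuclideanSpace ℝ (Fin N) → ℝ) (t : ℝ)
    (x y : EuclideanSpace ℝ (Fin N)) : ℝ≥0∞ :=
  ENNReal.ofReal |(if t < w x then (1 : ℝ) else 0) - if t < w y then 1 else 0| * kernel s x y

lemma measurable_levelIntegrand {α : Type*} [MeasurableSpace α]
    {w : EuclideanSpace ℝ (Fin N) → ℝ} (hw : Measurable w) {t : α → ℝ}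
    {x y : α → EuclideanSpace ℝ (Fin N)} (ht : Measurable t) (hx : Measurable x)
    (hy : Measurable y) : Measurable fun a => levelIntegrand s w (t a) (x a) (y a) := by
  have h1 : Measurable fun a => if t a < w (x a) then (1 : ℝ) else 0 :=
    Measurable.ite (measurableSet_lt ht (hw.comp hx)) measurable_const measurable_const
  have h2 : Measurable fun a => if t a < w (y a) then (1 : ℝ) else 0 :=
    Measurable.ite (measurableSet_lt ht (hw.comp hy)) measurable_const measurable_const
  have h3 : Measurable fun a => kernel s (x a) (y a) := by
    unfold kernel
    fun_prop
  exact (h1.sub h2).abs.ennreal_ofReal.mul h3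

lemma perimeter_superlevel_eq (w : EuclideanSpace ℝ (Fin N) → ℝ) (t : ℝ) :
    perimeter s {x | t < w x} = ∫⁻ x, ∫⁻ y, levelIntegrand s w t x y := by
  rw [perimeter, gagliardo_eq]
  simp only [indicator, mem_ofPred_eq, levelIntegrand]

lemma measurable_lintegral_levelIntegrand {w : EuclideanSpace ℝ (Fin N) → ℝ}
    (hw : Measurable w) :
    Measurable fun p : ℝ × EuclideanSpace ℝ (Fin N) => ∫⁻ y, levelIntegrand s w p.1 p.2 y :=
  Measurable.lintegral_prod_right' (f := fun q : (ℝ × EuclideanSpace ℝ (Fin N)) ×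
      EuclideanSpace ℝ (Fin N) => levelIntegrand s w q.1.1 q.1.2 q.2)
    (measurable_levelIntegrand hw (by fun_prop) (by fun_prop) (by fun_prop))

lemma measurable_perimeter_superlevel {w : EuclideanSpace ℝ (Fin N) → ℝ} (hw : Measurable w) :
    Measurable fun t : ℝ => perimeter s {x | t < w x} := by
  simp only [perimeter_superlevel_eq]
  exact (measurable_lintegral_levelIntegrand hw).lintegral_prod_right'

/-- The coarea formula for the Gagliardo seminorm of a nonnegative function. -/
lemma gagliardo_eq_lintegral_perimeter {w : EuclideanSpace ℝ (Fin N) → ℝ} (hw : Measurable w)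
    (h0 : ∀ x, 0 ≤ w x) :
    gagliardo s w = ∫⁻ t in Ioi (0 : ℝ), perimeter s {x | t < w x} := by
  simp only [perimeter_superlevel_eq]
  rw [lintegral_lintegral_swap
    (show AEMeasurable (Function.uncurry fun t x => ∫⁻ y, levelIntegrand s w t x y) _ from
      (measurable_lintegral_levelIntegrand hw).aemeasurable), gagliardo_eq]
  refine lintegral_congr fun x => ?_
  rw [lintegral_lintegral_swap
    (show AEMeasurable (Function.uncurry fun t y => levelIntegrand s w t x y) _ from
      (measurable_levelIntegrand hw (by fun_prop) (by fun_prop) (by fun_prop)).aemeasurable)]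
  refine lintegral_congr fun y => ?_
  have hm : Measurable fun t : ℝ =>
      ENNReal.ofReal |(if t < w x then (1 : ℝ) else 0) - if t < w y then 1 else 0| :=
    ((Measurable.ite measurableSet_Iio measurable_const measurable_const).sub
      (Measurable.ite measurableSet_Iio measurable_const measurable_const)).abs.ennreal_ofReal
  rw [ofReal_abs_sub_eq_lintegral (h0 x) (h0 y), ← lintegral_mul_const _ hm]
  simp only [levelIntegrand]

/-! ### The Cheeger inequality and its equality case -/

lemma cheegerConstant_mul_volume_le_perimeter {A : Set (EuclideanSpace ℝ (Fin N))}
    (hA : NullMeasurableSet A) (hAΩ : ∀ᵐ x ∂volume, x ∈ A → x ∈ Ω) (hΩ : MeasurableSet Ω)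
    (hA' : volume A ≠ ⊤) :
    cheegerConstant s Ω * volume A ≤ perimeter s A := by
  rcases eq_or_ne (volume A) 0 with h | h
  · simp [h]
  have hB : (A ∩ Ω : Set _) =ᵐ[volume] A := by
    rw [Filter.eventuallyEq_set]
    filter_upwards [hAΩ] with x hx
    exact ⟨fun h => h.1, fun h => ⟨h, hx h⟩⟩
  rw [← ENNReal.le_div_iff_mul_le (.inl h) (.inl hA'), ← perimeter_congr_ae hB, ← measure_congr hB]
  exact iInf₂_le (A ∩ Ω) ⟨inter_subset_right, hA.inter hΩ.nullMeasurableSet,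
    by rwa [measure_congr hB]⟩

/-- The coarea formula is stated for functions that are measurable and nonnegative everywhere;
taking the absolute value of a measurable representative secures both. -/
lemma exists_measurable_nonneg_ae_eq {w : EuclideanSpace ℝ (Fin N) → ℝ} (hw : AEMeasurable w)
    (h0 : ∀ x, 0 ≤ w x) :
    ∃ v : EuclideanSpace ℝ (Fin N) → ℝ, Measurable v ∧ (∀ x, 0 ≤ v x) ∧ w =ᵐ[volume] v := by
  refine ⟨fun x => |hw.mk w x|, hw.measurable_mk.abs, fun x => abs_nonneg _, ?_⟩
  filter_upwards [hw.ae_eq_mk] with x hx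
  rw [← hx, abs_of_nonneg (h0 x)]

lemma superlevel_ae_eq {w v : EuclideanSpace ℝ (Fin N) → ℝ} (h : w =ᵐ[volume] v) (t : ℝ) :
    {x | t < w x} =ᵐ[volume] {x | t < v x} := by
  rw [Filter.eventuallyEq_set]
  filter_upwards [h] with x hx
  simp [hx]

lemma cheegerConstant_mul_superlevel_le {w : EuclideanSpace ℝ (Fin N) → ℝ}
    (hΩ : MeasurableSet Ω) (hΩ' : volume Ω ≠ ⊤) (hw : AEMeasurable w)
    (hwΩ : ∀ᵐ x ∂volume, x ∉ Ω → w x = 0) {t : ℝ} (ht : 0 < t) :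
    cheegerConstant s Ω * volume {x | t < w x} ≤ perimeter s {x | t < w x} := by
  have hsub : ∀ᵐ x ∂volume, x ∈ {x | t < w x} → x ∈ Ω := by
    filter_upwards [hwΩ] with x hx (h : t < w x)
    by_contra hn
    exact (ht.trans h).ne' (hx hn)
  exact cheegerConstant_mul_volume_le_perimeter (nullMeasurableSet_lt aemeasurable_const hw) hsub hΩ
    (ne_top_of_le_ne_top hΩ' (measure_mono_ae hsub))

lemma cheegerConstant_mul_lintegral_eq
    {w : EuclideanSpace ℝ (Fin N) → ℝ} (hw : AEMeasurable w) (h0 : ∀ x, 0 ≤ w x) :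
    cheegerConstant s Ω * ∫⁻ x, ENNReal.ofReal (w x) =
      ∫⁻ t in Ioi (0 : ℝ), cheegerConstant s Ω * volume {x | t < w x} := by
  rw [lintegral_eq_lintegral_meas_lt volume (Filter.Eventually.of_forall h0) hw,
    lintegral_const_mul]
  exact Antitone.measurable fun a b hab => measure_mono fun x hx => lt_of_le_of_lt hab hx

lemma cheegerConstant_mul_lintegral_le (hΩ : MeasurableSet Ω) (hΩ' : volume Ω ≠ ⊤)
    {w : EuclideanSpace ℝ (Fin N) → ℝ} (hw : AEMeasurable w) (h0 : ∀ x, 0 ≤ w x)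
    (hwΩ : ∀ᵐ x ∂volume, x ∉ Ω → w x = 0) :
    cheegerConstant s Ω * ∫⁻ x, ENNReal.ofReal (w x) ≤ gagliardo s w := by
  obtain ⟨v, hv, hv0, hwv⟩ := exists_measurable_nonneg_ae_eq hw h0
  rw [cheegerConstant_mul_lintegral_eq hw h0, gagliardo_congr_ae hwv,
    gagliardo_eq_lintegral_perimeter hv hv0]
  refine setLIntegral_mono' measurableSet_Ioi fun t ht => ?_
  rw [← perimeter_congr_ae (superlevel_ae_eq hwv t)]
  exact cheegerConstant_mul_superlevel_le hΩ hΩ' hw hwΩ ht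

/-- Equality of the integrals over `t` of two ordered functions, the smaller one having finite
integral, forces equality for a.e. level. -/
lemma ae_isCheegerSet_superlevel (hΩ : MeasurableSet Ω) (hΩ' : volume Ω ≠ ⊤)
    {w : EuclideanSpace ℝ (Fin N) → ℝ} (hw : AEMeasurable w) (h0 : ∀ x, 0 ≤ w x)
    (hwΩ : ∀ᵐ x ∂volume, x ∉ Ω → w x = 0) (hfin : gagliardo s w ≠ ⊤)
    (hle : gagliardo s w ≤ cheegerConstant s Ω * ∫⁻ x, ENNReal.ofReal (w x)) :
    ∀ᵐ t : ℝ ∂volume, 0 < t → volume {x ∈ Ω | t < w x} ≠ 0 →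
      IsCheegerSet s Ω {x ∈ Ω | t < w x} := by
  obtain ⟨v, hv, hv0, hwv⟩ := exists_measurable_nonneg_ae_eq hw h0
  have key : (fun t => cheegerConstant s Ω * volume {x | t < w x})
      =ᵐ[volume.restrict (Ioi 0)] fun t => perimeter s {x | t < v x} := by
    refine ae_eq_of_ae_le_of_lintegral_le ?_ ?_ ?_ ?_
    · refine (ae_restrict_iff' measurableSet_Ioi).2 (Filter.Eventually.of_forall fun t ht => ?_)
      beta_reduce
      rw [← perimeter_congr_ae (superlevel_ae_eq hwv t)]
      exact cheegerConstant_mul_superlevel_le hΩ hΩ' hw hwΩ ht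
    · rw [← cheegerConstant_mul_lintegral_eq hw h0]
      exact ne_top_of_le_ne_top hfin (cheegerConstant_mul_lintegral_le hΩ hΩ' hw h0 hwΩ)
    · exact (measurable_perimeter_superlevel hv).aemeasurable
    · rwa [← cheegerConstant_mul_lintegral_eq hw h0, ← gagliardo_eq_lintegral_perimeter hv hv0,
        ← gagliardo_congr_ae hwv]
  filter_upwards [(ae_restrict_iff' measurableSet_Ioi).1 key] with t ht ht0 hvol
  have hset : {x ∈ Ω | t < w x} =ᵐ[volume] {x | t < w x} := by
    rw [Filter.eventuallyEq_set]
    filter_upwards [hwΩ] with x hx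
    refine ⟨fun h => h.2, fun (h : t < w x) => ⟨?_, h⟩⟩
    by_contra hn
    exact (ht0.trans h).ne' (hx hn)
  have hadm : IsAdmissible Ω {x ∈ Ω | t < w x} :=
    ⟨fun x hx => hx.1,
      hΩ.nullMeasurableSet.inter (nullMeasurableSet_lt aemeasurable_const hw), hvol⟩
  refine ⟨hadm, ?_⟩
  rw [perimeter_congr_ae (hset.trans (superlevel_ae_eq hwv t)), ← ht ht0, measure_congr hset]
  refine ENNReal.mul_div_cancel_right (by rwa [← measure_congr hset]) ?_
  rw [← measure_congr hset]
  exact ne_top_of_le_ne_top hΩ' (measure_mono fun x hx => hx.1)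

lemma MemCalW.aemeasurable {u : EuclideanSpace ℝ (Fin N) → ℝ} (hΩ : MeasurableSet Ω)
    (hu : MemCalW s Ω u) : AEMeasurable u := by
  have h : Ω.indicator u =ᵐ[volume] u := by
    filter_upwards [hu.2.2] with x hx
    by_cases hxΩ : x ∈ Ω
    · simp [hxΩ]
    · simp [hxΩ, hx hxΩ]
  exact ((aemeasurable_indicator_iff hΩ).2 hu.1.aemeasurable).congr h

lemma MemCalW.eLpNorm_eq {u : EuclideanSpace ℝ (Fin N) → ℝ} (hΩ : MeasurableSet Ω)
    (hu : MemCalW s Ω u) :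
    eLpNorm u 1 (volume.restrict Ω) = ∫⁻ x, ENNReal.ofReal |u x| := by
  rw [eLpNorm_one_eq_lintegral_enorm, ← lintegral_indicator hΩ]
  refine lintegral_congr_ae ?_
  filter_upwards [hu.2.2] with x hx
  by_cases hxΩ : x ∈ Ω
  · simp [hxΩ, Real.enorm_eq_ofReal_abs]
  · simp [hxΩ, hx hxΩ]

lemma MemCalW.eLpNorm_ne_top {u : EuclideanSpace ℝ (Fin N) → ℝ}
    (hu : MemCalW s Ω u) : eLpNorm u 1 (volume.restrict Ω) ≠ ⊤ :=
  (memLp_one_iff_integrable.2 hu.1).2.ne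

lemma MemCalW.eLpNorm_ne_zero {u : EuclideanSpace ℝ (Fin N) → ℝ} (hΩ : MeasurableSet Ω)
    (hu : MemCalW s Ω u) (h : ¬ ∀ᵐ x ∂volume, u x = 0) :
    eLpNorm u 1 (volume.restrict Ω) ≠ 0 := by
  rw [hu.eLpNorm_eq hΩ, Ne, lintegral_eq_zero_iff' (hu.aemeasurable hΩ).abs.ennreal_ofReal]
  contrapose! h
  filter_upwards [h] with x hx
  simpa using hx

/-- The Cheeger inequality. -/
lemma MemCalW.cheegerConstant_mul_eLpNorm_le {u : EuclideanSpace ℝ (Fin N) → ℝ}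
    (hΩ : MeasurableSet Ω) (hΩ' : volume Ω ≠ ⊤) (hu : MemCalW s Ω u) :
    cheegerConstant s Ω * eLpNorm u 1 (volume.restrict Ω) ≤ gagliardo s u := by
  rw [hu.eLpNorm_eq hΩ]
  refine (cheegerConstant_mul_lintegral_le hΩ hΩ' (hu.aemeasurable hΩ).abs
    (fun x => abs_nonneg _) ?_).trans (gagliardo_mono fun x y => abs_abs_sub_abs_le _ _)
  filter_upwards [hu.2.2] with x hx h
  simp [hx h]

lemma MemCalW.ae_isCheegerSet_of_eq {u : EuclideanSpace ℝ (Fin N) → ℝ}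
    (hΩ : MeasurableSet Ω) (hΩ' : volume Ω ≠ ⊤) (hu : MemCalW s Ω u)
    (heq : gagliardo s u = cheegerConstant s Ω * eLpNorm u 1 (volume.restrict Ω)) :
    ∀ᵐ t : ℝ ∂volume, 0 < t →
      (volume {x ∈ Ω | t < |u x|} ≠ 0 → IsCheegerSet s Ω {x ∈ Ω | t < |u x|}) ∧
      (volume {x ∈ Ω | t < u x} ≠ 0 → IsCheegerSet s Ω {x ∈ Ω | t < u x}) ∧
      (volume {x ∈ Ω | u x < -t} ≠ 0 → IsCheegerSet s Ω {x ∈ Ω | u x < -t}) := by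
  have hm := hu.aemeasurable hΩ
  have hz := hu.2.2
  have hfin := hu.2.1.ne
  rw [hu.eLpNorm_eq hΩ] at heq
  have hp : AEMeasurable fun x => max (u x) 0 := hm.max aemeasurable_const
  have hn : AEMeasurable fun x => max (-u x) 0 := hm.neg.max aemeasurable_const
  have hpz : ∀ᵐ x ∂volume, x ∉ Ω → max (u x) 0 = 0 := by
    filter_upwards [hz] with x hx h; simp [hx h]
  have hnz : ∀ᵐ x ∂volume, x ∉ Ω → max (-u x) 0 = 0 := by
    filter_upwards [hz] with x hx h; simp [hx h]
  have haz : ∀ᵐ x ∂volume, x ∉ Ω → |u x| = 0 := by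
    filter_upwards [hz] with x hx h; simp [hx h]
  have hle_abs : gagliardo s (fun x => |u x|) ≤ gagliardo s u :=
    gagliardo_mono fun x y => abs_abs_sub_abs_le _ _
  have hsplit := gagliardo_eq_posPart_add_negPart (s := s) hm
  have hnorm : ∫⁻ x, ENNReal.ofReal |u x| =
      (∫⁻ x, ENNReal.ofReal (max (u x) 0)) + ∫⁻ x, ENNReal.ofReal (max (-u x) 0) := by
    rw [← lintegral_add_left' hp.ennreal_ofReal]
    refine lintegral_congr fun x => ?_
    rw [← ENNReal.ofReal_add (le_max_right _ _) (le_max_right _ _)]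
    congr 1
    grind
  have hP := cheegerConstant_mul_lintegral_le (s := s) hΩ hΩ' hp (fun x => le_max_right _ _) hpz
  have hM := cheegerConstant_mul_lintegral_le (s := s) hΩ hΩ' hn (fun x => le_max_right _ _) hnz
  have hfinP : gagliardo s (fun x => max (u x) 0) ≠ ⊤ :=
    ne_top_of_le_ne_top hfin (hsplit ▸ le_self_add)
  have hfinM : gagliardo s (fun x => max (-u x) 0) ≠ ⊤ :=
    ne_top_of_le_ne_top hfin (hsplit ▸ le_add_self)
  rw [hnorm, mul_add, hsplit] at heq
  -- The two Cheeger inequalities for `u⁺` and `u⁻` add up to an equality, so each is one;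
  -- subtracting the other part is legitimate because its seminorm is finite.
  have hP' : gagliardo s (fun x => max (u x) 0) ≤
      cheegerConstant s Ω * ∫⁻ x, ENNReal.ofReal (max (u x) 0) :=
    (ENNReal.add_le_add_iff_right hfinM).1 (heq.le.trans (by gcongr))
  have hM' : gagliardo s (fun x => max (-u x) 0) ≤
      cheegerConstant s Ω * ∫⁻ x, ENNReal.ofReal (max (-u x) 0) :=
    (ENNReal.add_le_add_iff_left hfinP).1 (heq.le.trans (by gcongr))
  filter_upwards [
    ae_isCheegerSet_superlevel hΩ hΩ' hm.abs (fun x => abs_nonneg _) haz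
      (ne_top_of_le_ne_top hfin hle_abs)
      (by rw [hnorm, mul_add, ← heq, ← hsplit]; exact hle_abs),
    ae_isCheegerSet_superlevel hΩ hΩ' hp (fun x => le_max_right _ _) hpz hfinP hP',
    ae_isCheegerSet_superlevel hΩ hΩ' hn (fun x => le_max_right _ _) hnz hfinM hM'] with t h1 h2 h3 ht
  have e2 : {x ∈ Ω | t < max (u x) 0} = {x ∈ Ω | t < u x} := by
    ext x; simp [ht.not_gt]
  have e3 : {x ∈ Ω | t < max (-u x) 0} = {x ∈ Ω | u x < -t} := by
    ext x; simp [ht.not_gt, lt_neg]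
  rw [e2] at h2
  rw [e3] at h3
  exact ⟨h1 ht, h2 ht, h3 ht⟩

/-! ### Mollification and competitors with compact support in `Ω` -/

open scoped Convolution in
lemma enorm_convolution_sub_le {ρ v : EuclideanSpace ℝ (Fin N) → ℝ} (hρ : Continuous ρ)
    (hρc : HasCompactSupport ρ) (hρ0 : ∀ x, 0 ≤ ρ x) (hv : LocallyIntegrable v)
    (x y : EuclideanSpace ℝ (Fin N)) :
    ENNReal.ofReal |(ρ ⋆[ContinuousLinearMap.lsmul ℝ ℝ, volume] v) x -
        (ρ ⋆[ContinuousLinearMap.lsmul ℝ ℝ, volume] v) y| ≤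
      ∫⁻ t, ENNReal.ofReal (ρ t) * ENNReal.ofReal |v (x - t) - v (y - t)| := by
  have hc := hρc.convolutionExists_left (ContinuousLinearMap.lsmul ℝ ℝ) hρ hv
  have hx : Integrable (fun t => ρ t * v (x - t)) := hc x
  have hy : Integrable (fun t => ρ t * v (y - t)) := hc y
  simp only [convolution_def, ContinuousLinearMap.lsmul_apply, smul_eq_mul]
  rw [← integral_sub hx hy, ← Real.enorm_eq_ofReal_abs]
  refine (enorm_integral_le_lintegral_enorm _).trans (lintegral_mono fun t => le_of_eq ?_)
  rw [← mul_sub, Real.enorm_eq_ofReal_abs, abs_mul, abs_of_nonneg (hρ0 t),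
    ENNReal.ofReal_mul (hρ0 t)]

/-- The kernel depends only on `x - y`, and Lebesgue measure is translation invariant. -/
lemma lintegral_translate_eq_gagliardo (v : EuclideanSpace ℝ (Fin N) → ℝ)
    (t : EuclideanSpace ℝ (Fin N)) :
    ∫⁻ x, ∫⁻ y, ENNReal.ofReal |v (x - t) - v (y - t)| * kernel s x y = gagliardo s v := by
  have h : ∀ x y, kernel s x y = kernel s (x - t) (y - t) := fun x y => by
    simp only [kernel, sub_sub_sub_cancel_right]
  refine (lintegral_congr fun x => lintegral_congr fun y => by rw [h x y]).trans ?_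
  rw [lintegral_sub_right_eq_self
    (fun x => ∫⁻ y, ENNReal.ofReal |v x - v (y - t)| * kernel s x (y - t)) t, gagliardo_eq]
  exact lintegral_congr fun x => lintegral_sub_right_eq_self
    (fun y => ENNReal.ofReal |v x - v y| * kernel s x y) t

open scoped Convolution in
/-- Mollification does not increase the Gagliardo seminorm. -/
lemma gagliardo_convolution_le {ρ v : EuclideanSpace ℝ (Fin N) → ℝ} (hρ : Continuous ρ)
    (hρc : HasCompactSupport ρ) (hρ0 : ∀ x, 0 ≤ ρ x) (hρ1 : ∫ x, ρ x = 1) (hvm : Measurable v)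
    (hv : LocallyIntegrable v) :
    gagliardo s (ρ ⋆[ContinuousLinearMap.lsmul ℝ ℝ, volume] v) ≤ gagliardo s v := by
  -- After Tonelli moves the mollification variable `t` outermost, the inner double integral is the
  -- seminorm of a translate, and `ρ` has mass 1.
  let F : EuclideanSpace ℝ (Fin N) → EuclideanSpace ℝ (Fin N) → EuclideanSpace ℝ (Fin N) → ℝ≥0∞ :=
    fun x y t => ENNReal.ofReal (ρ t) * (ENNReal.ofReal |v (x - t) - v (y - t)| * kernel s x y)
  have hF : ∀ {α : Type} [MeasurableSpace α] {x y t : α → EuclideanSpace ℝ (Fin N)},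
      Measurable x → Measurable y → Measurable t → Measurable fun a => F (x a) (y a) (t a) := by
    intro α _ x y t hx hy ht
    have h3 : Measurable fun a => kernel s (x a) (y a) := by
      unfold kernel
      fun_prop
    have h1 : Measurable fun a => ENNReal.ofReal (ρ (t a)) :=
      (hρ.measurable.comp ht).ennreal_ofReal
    exact h1.mul ((((hvm.comp (hx.sub ht)).sub (hvm.comp (hy.sub ht))).abs.ennreal_ofReal).mul h3)
  have hone : ∫⁻ t, ENNReal.ofReal (ρ t) = 1 := by
    rw [← ofReal_integral_eq_lintegral_ofReal (hρ.integrable_of_hasCompactSupport hρc)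
      (Filter.Eventually.of_forall hρ0), hρ1, ENNReal.ofReal_one]
  calc gagliardo s (ρ ⋆[ContinuousLinearMap.lsmul ℝ ℝ, volume] v)
      ≤ ∫⁻ x, ∫⁻ y, ∫⁻ t, F x y t := by
        rw [gagliardo_eq]
        refine lintegral_mono fun x => lintegral_mono fun y => ?_
        refine (mul_le_mul_left (enorm_convolution_sub_le hρ hρc hρ0 hv x y) _).trans
          (le_of_eq ?_)
        rw [← lintegral_mul_const]
        · simp only [F, mul_assoc]
        · have h1 : Measurable fun t => ENNReal.ofReal (ρ t) := hρ.measurable.ennreal_ofReal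
          exact h1.mul ((hvm.comp (by fun_prop)).sub (hvm.comp (by fun_prop))).abs.ennreal_ofReal
    _ = ∫⁻ x, ∫⁻ t, ∫⁻ y, F x y t := by
        refine lintegral_congr fun x => lintegral_lintegral_swap ?_
        exact (hF measurable_const measurable_fst measurable_snd).aemeasurable
    _ = ∫⁻ t, ∫⁻ x, ∫⁻ y, F x y t := by
        refine lintegral_lintegral_swap ?_
        have h : Measurable fun p : (EuclideanSpace ℝ (Fin N) × EuclideanSpace ℝ (Fin N)) ×
            EuclideanSpace ℝ (Fin N) => F p.1.1 p.2 p.1.2 :=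
          hF (by fun_prop) (by fun_prop) (by fun_prop)
        exact h.lintegral_prod_right'.aemeasurable
    _ = ∫⁻ t, ENNReal.ofReal (ρ t) * gagliardo s v := by
        refine lintegral_congr fun t => ?_
        rw [← lintegral_translate_eq_gagliardo v t,
          ← lintegral_const_mul' _ _ ENNReal.ofReal_ne_top]
        exact lintegral_congr fun x => lintegral_const_mul' _ _ ENNReal.ofReal_ne_top
    _ = gagliardo s v := by
        rw [lintegral_mul_const _ hρ.measurable.ennreal_ofReal, hone, one_mul]

lemma firstEigenvalue_mul_le_of_isTestFunction (hΩ : MeasurableSet Ω)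
    {φ : EuclideanSpace ℝ (Fin N) → ℝ}
    (hφ : IsTestFunction Ω φ) (h0 : ∀ x, 0 ≤ φ x) :
    firstEigenvalue s Ω * ∫⁻ x, ENNReal.ofReal (φ x) ≤ gagliardo s φ := by
  have hint : Integrable φ := hφ.1.continuous.integrable_of_hasCompactSupport hφ.2.1
  have hnorm : ∫⁻ x, ENNReal.ofReal (φ x) = ENNReal.ofReal (∫ x, φ x) :=
    (ofReal_integral_eq_lintegral_ofReal hint (Filter.Eventually.of_forall h0)).symm
  rw [hnorm]
  rcases (integral_nonneg (μ := volume) (f := φ) h0).eq_or_lt with hI | hI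
  · simp [← hI]
  -- Membership in the function space requires a finite seminorm; otherwise the bound is trivial.
  rcases eq_or_ne (gagliardo s φ) ⊤ with hg | hg
  · simp [hg]
  set I := ∫ x, φ x
  have hz : ∀ x, x ∉ Ω → φ x = 0 := fun x hx =>
    image_eq_zero_of_notMem_tsupport fun h => hx (hφ.2.2 h)
  have htest : IsTestFunction Ω fun x => I⁻¹ * φ x :=
    ⟨contDiff_const.mul hφ.1, hφ.2.1.mul_left,
      (tsupport_mul_subset_right (f := fun _ => I⁻¹)).trans hφ.2.2⟩
  have hmem : MemCalW s Ω fun x => I⁻¹ * φ x :=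
    ⟨(hint.const_mul _).integrableOn, by
      rw [gagliardo_const_mul]; exact ENNReal.mul_lt_top ENNReal.ofReal_lt_top hg.lt_top,
      Filter.Eventually.of_forall fun x hx => by simp [hz x hx]⟩
  have hle : firstEigenvalue s Ω ≤ gagliardo s fun x => I⁻¹ * φ x := by
    refine iInf₂_le _ ⟨⟨hmem, fun ε hε => ⟨_, htest, ?_⟩⟩, ?_, ?_⟩
    -- The normalised test function approximates itself.
    · simpa [gagliardo_eq] using hε
    · rw [hmem.eLpNorm_eq hΩ]
      simp only [abs_mul, abs_of_pos (inv_pos.2 hI), abs_of_nonneg (h0 _),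
        ENNReal.ofReal_mul (inv_pos.2 hI).le]
      rw [lintegral_const_mul' _ _ ENNReal.ofReal_ne_top, hnorm,
        ← ENNReal.ofReal_mul (inv_pos.2 hI).le, inv_mul_cancel₀ hI.ne', ENNReal.ofReal_one]
    · exact Filter.Eventually.of_forall fun x => mul_nonneg (inv_pos.2 hI).le (h0 x)
  rw [gagliardo_const_mul, abs_of_pos (inv_pos.2 hI)] at hle
  calc _ ≤ ENNReal.ofReal I⁻¹ * gagliardo s φ * ENNReal.ofReal I := by gcongr
    _ = gagliardo s φ := by
      rw [mul_right_comm, ← ENNReal.ofReal_mul (inv_pos.2 hI).le, inv_mul_cancel₀ hI.ne',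
        ENNReal.ofReal_one, one_mul]

-- Mollifying at a scale `ε` whose closed `ε`-neighbourhood of `K` stays in `Ω` gives a nonnegative
-- test function with the same integral and no larger seminorm.
open scoped Convolution in
lemma firstEigenvalue_mul_le (hΩ : IsOpen Ω) {v : EuclideanSpace ℝ (Fin N) → ℝ}
    (hvm : Measurable v) (hv : Integrable v) (h0 : ∀ x, 0 ≤ v x)
    {K : Set (EuclideanSpace ℝ (Fin N))} (hK : IsCompact K) (hKΩ : K ⊆ Ω)
    (hvK : Function.support v ⊆ K) :
    firstEigenvalue s Ω * ∫⁻ x, ENNReal.ofReal (v x) ≤ gagliardo s v := by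
  obtain ⟨ε, hε, hεΩ⟩ := hK.exists_cthickening_subset_open hΩ hKΩ
  let φ : ContDiffBump (0 : EuclideanSpace ℝ (Fin N)) := ⟨ε / 2, ε, by linarith, by linarith⟩
  let ρ := φ.normed volume
  have hρ : ContDiff ℝ ∞ ρ := φ.contDiff_normed
  have hρ0 : ∀ x, 0 ≤ ρ x := φ.nonneg_normed
  have hρ1 : ∫ x, ρ x = 1 := φ.integral_normed
  have hρc : HasCompactSupport ρ := φ.hasCompactSupport_normed
  have hρi : Integrable ρ := hρ.continuous.integrable_of_hasCompactSupport hρc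
  set w := ρ ⋆[ContinuousLinearMap.lsmul ℝ ℝ, volume] v with hw
  have hsupp : tsupport w ⊆ Metric.cthickening ε K := by
    refine closure_minimal ((support_convolution_subset _).trans ?_) Metric.isClosed_cthickening
    rintro _ ⟨a, ha, b, hb, rfl⟩
    rw [φ.support_normed_eq, Metric.mem_ball, dist_zero_right] at ha
    refine Metric.mem_cthickening_of_dist_le _ b ε K (hvK hb) ?_
    simpa using ha.le
  have hw0 : ∀ x, 0 ≤ w x := fun x =>
    integral_nonneg fun t => mul_nonneg (hρ0 t) (h0 (x - t))
  have htest : IsTestFunction Ω w :=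
    ⟨hρc.contDiff_convolution_left _ hρ hv.locallyIntegrable,
      HasCompactSupport.of_support_subset_isCompact hK.cthickening
        ((subset_tsupport w).trans hsupp), hsupp.trans hεΩ⟩
  have hnorm : ∫⁻ x, ENNReal.ofReal (w x) = ∫⁻ x, ENNReal.ofReal (v x) := by
    rw [← ofReal_integral_eq_lintegral_ofReal
      (htest.1.continuous.integrable_of_hasCompactSupport htest.2.1)
      (Filter.Eventually.of_forall hw0),
      ← ofReal_integral_eq_lintegral_ofReal hv (Filter.Eventually.of_forall h0), hw,
      integral_convolution _ hρi hv, hρ1]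
    simp
  rw [← hnorm]
  exact (firstEigenvalue_mul_le_of_isTestFunction hΩ.measurableSet htest hw0).trans
    (gagliardo_convolution_le hρ.continuous hρc hρ0 hρ1 hvm hv.locallyIntegrable)

/-! ### The cost of a Lipschitz cut-off -/

/-- In polar coordinates the radial density is `r^(-s)` on `(0, 1]`, integrable since `s < 1`, and
`r^(-1-s)` beyond, integrable since `s > 0`. -/
lemma integrable_truncated_kernel (hN : 1 ≤ N) (hs : s ∈ Ioo (0 : ℝ) 1) :
    Integrable fun z : EuclideanSpace ℝ (Fin N) =>
      min 1 ‖z‖ * (‖z‖ ^ ((N : ℝ) + s))⁻¹ := by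
  have hfr : Module.finrank ℝ (EuclideanSpace ℝ (Fin N)) = N := by simp
  have : Nontrivial (EuclideanSpace ℝ (Fin N)) :=
    Module.nontrivial_of_finrank_pos (R := ℝ) (by rw [hfr]; omega)
  refine (integrable_fun_norm_addHaar (volume : Measure (EuclideanSpace ℝ (Fin N)))
    (f := fun r : ℝ => min 1 r * (r ^ ((N : ℝ) + s))⁻¹)).2 ?_
  rw [hfr, ← Ioc_union_Ioi_eq_Ioi (zero_le_one' ℝ)]
  have hpow : ∀ r : ℝ, 0 < r → r ^ (N - 1) * (r ^ ((N : ℝ) + s))⁻¹ = r ^ (-1 - s) := by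
    intro r hr
    rw [← Real.rpow_natCast, ← Real.rpow_neg hr.le, ← Real.rpow_add hr]
    congr 1
    push_cast [Nat.cast_sub hN]
    ring
  refine IntegrableOn.union ?_ ?_
  · have h : IntegrableOn (fun r : ℝ => r ^ (-s)) (Ioc 0 1) :=
      (intervalIntegrable_iff_integrableOn_Ioc_of_le zero_le_one).1
        (intervalIntegral.intervalIntegrable_rpow' (by linarith [hs.2]))
    refine h.congr_fun (fun r hr => ?_) measurableSet_Ioc
    change r ^ (-s) = r ^ (N - 1) * (min 1 r * _)
    rw [min_eq_right hr.2, mul_left_comm, hpow r hr.1]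
    have h1 := Real.rpow_add hr.1 1 (-1 - s)
    rw [Real.rpow_one] at h1
    rw [← h1]
    congr 1
    ring
  · refine (integrableOn_Ioi_rpow_of_lt (a := -1 - s) (by linarith [hs.1]) one_pos).congr_fun
      (fun r hr => ?_) measurableSet_Ioi
    change _ = r ^ (N - 1) * (min 1 r * _)
    rw [min_eq_left (le_of_lt hr), one_mul, hpow r (one_pos.trans hr)]

/-- Rescaling by `δ` reduces to `δ = 1`: the kernel contributes `δ^(-(N+s))` and the volume element
`δ^N`. -/
lemma exists_lintegral_truncated_kernel_le (hN : 1 ≤ N) (hs : s ∈ Ioo (0 : ℝ) 1) :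
    ∃ C : ℝ≥0∞, C ≠ ⊤ ∧ ∀ δ : ℝ, 0 < δ → ∀ x : EuclideanSpace ℝ (Fin N),
      ∫⁻ y, ENNReal.ofReal (min 1 (‖x - y‖ / δ)) * kernel s x y ≤
        C * ENNReal.ofReal (δ ^ (-s)) := by
  have hint := integrable_truncated_kernel (N := N) hN hs
  set f : EuclideanSpace ℝ (Fin N) → ℝ := fun z => min 1 ‖z‖ * (‖z‖ ^ ((N : ℝ) + s))⁻¹ with hf
  have hf0 : ∀ z, 0 ≤ f z := fun z => by positivity
  refine ⟨ENNReal.ofReal (∫ z, f z), ENNReal.ofReal_ne_top, fun δ hδ x => le_of_eq ?_⟩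
  have hscale : ∀ z : EuclideanSpace ℝ (Fin N),
      ENNReal.ofReal (min 1 (‖z‖ / δ)) * ENNReal.ofReal ((‖z‖ ^ ((N : ℝ) + s))⁻¹) =
        ENNReal.ofReal (δ ^ (-((N : ℝ) + s)) * f (δ⁻¹ • z)) := by
    intro z
    rw [← ENNReal.ofReal_mul (by positivity)]
    congr 1
    simp only [hf, norm_smul, norm_inv, Real.norm_eq_abs, abs_of_pos hδ]
    rw [Real.mul_rpow (by positivity) (by positivity), Real.inv_rpow hδ.le, Real.rpow_neg hδ.le,
      div_eq_inv_mul, mul_inv, inv_inv]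
    have : δ ^ ((N : ℝ) + s) ≠ 0 := (Real.rpow_pos_of_pos hδ _).ne'
    field_simp
  simp only [kernel]
  rw [lintegral_sub_left_eq_self (fun z : EuclideanSpace ℝ (Fin N) =>
    ENNReal.ofReal (min 1 (‖z‖ / δ)) * ENNReal.ofReal ((‖z‖ ^ ((N : ℝ) + s))⁻¹)) x]
  simp only [hscale]
  rw [← ofReal_integral_eq_lintegral_ofReal
    ((hint.comp_smul (inv_ne_zero hδ.ne')).const_mul _)
    (Filter.Eventually.of_forall fun z =>
      mul_nonneg (Real.rpow_nonneg hδ.le _) (hf0 _)),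
    integral_const_mul, Measure.integral_comp_smul, ← ENNReal.ofReal_mul (integral_nonneg hf0)]
  congr 1
  rw [finrank_euclideanSpace_fin, inv_pow, inv_inv, abs_of_pos (pow_pos hδ _), smul_eq_mul,
    ← mul_assoc, ← Real.rpow_natCast, ← Real.rpow_add hδ, mul_comm]
  congr 2
  ring

/-- The kernel of the Gagliardo seminorm, damped at distances smaller than `δ`. -/
noncomputable def truncatedKernel (s δ : ℝ) (x y : EuclideanSpace ℝ (Fin N)) : ℝ≥0∞ :=
  ENNReal.ofReal (min 1 (‖x - y‖ / δ)) * kernel s x y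

lemma truncatedKernel_comm (δ : ℝ) (x y : EuclideanSpace ℝ (Fin N)) :
    truncatedKernel s δ x y = truncatedKernel s δ y x := by
  simp only [truncatedKernel, norm_sub_rev x y, kernel_comm x y]

lemma measurable_truncatedKernel (δ : ℝ) :
    Measurable fun p : EuclideanSpace ℝ (Fin N) × EuclideanSpace ℝ (Fin N) =>
      truncatedKernel s δ p.1 p.2 :=
  Measurable.mul (by fun_prop) measurable_kernel

lemma measurable_indicator_fst_mul_truncatedKernel {L : Set (EuclideanSpace ℝ (Fin N))}
    (hL : MeasurableSet L) (δ : ℝ) :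
    Measurable fun p : EuclideanSpace ℝ (Fin N) × EuclideanSpace ℝ (Fin N) =>
      L.indicator (fun _ => (1 : ℝ≥0∞)) p.1 * truncatedKernel s δ p.1 p.2 :=
  Measurable.mul ((measurable_const.indicator hL).comp measurable_fst)
    (measurable_truncatedKernel δ)

lemma measurable_indicator_snd_mul_truncatedKernel {L : Set (EuclideanSpace ℝ (Fin N))}
    (hL : MeasurableSet L) (δ : ℝ) :
    Measurable fun p : EuclideanSpace ℝ (Fin N) × EuclideanSpace ℝ (Fin N) =>
      L.indicator (fun _ => (1 : ℝ≥0∞)) p.2 * truncatedKernel s δ p.1 p.2 :=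
  Measurable.mul ((measurable_const.indicator hL).comp measurable_snd)
    (measurable_truncatedKernel δ)

lemma lintegral_indicator_mul_truncatedKernel_le {L : Set (EuclideanSpace ℝ (Fin N))}
    (hL : MeasurableSet L) {δ : ℝ} {B : ℝ≥0∞}
    (hB : ∀ x : EuclideanSpace ℝ (Fin N), ∫⁻ y, truncatedKernel s δ x y ≤ B) :
    ∫⁻ x, ∫⁻ y, L.indicator (fun _ => (1 : ℝ≥0∞)) x * truncatedKernel s δ x y ≤ volume L * B := by
  calc _ = ∫⁻ x, L.indicator (fun _ => (1 : ℝ≥0∞)) x * ∫⁻ y, truncatedKernel s δ x y := by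
        refine lintegral_congr fun x => lintegral_const_mul' _ _ ?_
        by_cases hx : x ∈ L <;> simp [hx]
    _ ≤ ∫⁻ x, L.indicator (fun _ => (1 : ℝ≥0∞)) x * B :=
        lintegral_mono fun x => mul_le_mul_right (hB x) _
    _ = volume L * B := by
        rw [lintegral_mul_const _ (measurable_const.indicator hL),
          lintegral_indicator_const hL, one_mul]

/-- If both points lie in `A`, the left side vanishes unless one of them is in `L`, and then the
Lipschitz and unit bounds on `η` give the truncated kernel. If exactly one lies in `A`, then `η ≤ 1`
and the perimeter integrand suffices. -/
lemma indicator_cutoff_sub_mul_kernel_le {A L : Set (EuclideanSpace ℝ (Fin N))}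
    {η : EuclideanSpace ℝ (Fin N) → ℝ} {δ : ℝ}
    (h0 : ∀ x, 0 ≤ η x) (h1 : ∀ x, η x ≤ 1) (hη : ∀ x y, |η x - η y| ≤ ‖x - y‖ / δ)
    (hηL : ∀ x ∈ A, x ∉ L → η x = 1) (x y : EuclideanSpace ℝ (Fin N)) :
    ENNReal.ofReal |A.indicator η x - A.indicator η y| * kernel s x y ≤
      ENNReal.ofReal |A.indicator (fun _ => (1 : ℝ)) x - A.indicator (fun _ => (1 : ℝ)) y| *
        kernel s x y + (L.indicator (fun _ => (1 : ℝ≥0∞)) x * truncatedKernel s δ x y +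
          L.indicator (fun _ => (1 : ℝ≥0∞)) y * truncatedKernel s δ x y) := by
  by_cases hx : x ∈ A <;> by_cases hy : y ∈ A
  · have hle : ENNReal.ofReal |η x - η y| * kernel s x y ≤ truncatedKernel s δ x y := by
      refine mul_le_mul_left (ENNReal.ofReal_le_ofReal (le_min ?_ (hη x y))) _
      rw [abs_le]
      constructor <;> linarith [h0 x, h0 y, h1 x, h1 y]
    by_cases hxL : x ∈ L
    · simp only [hx, hy, hxL, indicator_of_mem, one_mul]
      exact hle.trans (le_add_left le_self_add)
    · by_cases hyL : y ∈ L
      · simp only [hx, hy, hyL, indicator_of_mem, one_mul]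
        exact hle.trans (le_add_left le_add_self)
      · simp [hx, hy, hηL x hx hxL, hηL y hy hyL]
  · refine le_add_right (mul_le_mul_left (ENNReal.ofReal_le_ofReal ?_) _)
    simpa [hx, hy, abs_of_nonneg (h0 x)] using h1 x
  · refine le_add_right (mul_le_mul_left (ENNReal.ofReal_le_ofReal ?_) _)
    simpa [hx, hy, abs_of_nonneg (h0 y)] using h1 y
  · simp [hx, hy]

/-- Multiplying a characteristic function by a Lipschitz cut-off which differs from `1` only on a
thin layer `L` increases the Gagliardo seminorm by a controlled amount. -/
lemma gagliardo_indicator_cutoff_le {A L : Set (EuclideanSpace ℝ (Fin N))}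
    {η : EuclideanSpace ℝ (Fin N) → ℝ} {δ : ℝ} {B : ℝ≥0∞} (hL : MeasurableSet L)
    (h0 : ∀ x, 0 ≤ η x) (h1 : ∀ x, η x ≤ 1) (hη : ∀ x y, |η x - η y| ≤ ‖x - y‖ / δ)
    (hηL : ∀ x ∈ A, x ∉ L → η x = 1)
    (hB : ∀ x : EuclideanSpace ℝ (Fin N), ∫⁻ y, truncatedKernel s δ x y ≤ B) :
    gagliardo s (A.indicator η) ≤ perimeter s A + 2 * (volume L * B) := by
  have hk1 := measurable_indicator_fst_mul_truncatedKernel (s := s) hL δ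
  have hk2 := measurable_indicator_snd_mul_truncatedKernel (s := s) hL δ
  have hI1 := lintegral_indicator_mul_truncatedKernel_le hL hB
  have hI2 : ∫⁻ x, ∫⁻ y, L.indicator (fun _ => (1 : ℝ≥0∞)) y * truncatedKernel s δ x y ≤
      volume L * B := by
    rw [lintegral_lintegral_swap hk2.aemeasurable]
    simpa only [truncatedKernel_comm] using hI1
  have hm1 : Measurable fun x => ∫⁻ y, L.indicator (fun _ => (1 : ℝ≥0∞)) x *
    truncatedKernel s δ x y := hk1.lintegral_prod_right'
  have hm2 : Measurable fun x => ∫⁻ y, L.indicator (fun _ => (1 : ℝ≥0∞)) y *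
    truncatedKernel s δ x y := hk2.lintegral_prod_right'
  have hx1 : ∀ x, Measurable fun y => L.indicator (fun _ => (1 : ℝ≥0∞)) x *
    truncatedKernel s δ x y := fun x => hk1.comp measurable_prodMk_left
  have hx2 : ∀ x, Measurable fun y => L.indicator (fun _ => (1 : ℝ≥0∞)) y *
    truncatedKernel s δ x y := fun x => hk2.comp measurable_prodMk_left
  rw [gagliardo_eq, perimeter, gagliardo_eq, two_mul]
  refine (lintegral_mono fun x => lintegral_mono fun y =>
    indicator_cutoff_sub_mul_kernel_le h0 h1 hη hηL x y).trans ?_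
  refine le_trans (le_of_eq ?_) (add_le_add_right (add_le_add hI1 hI2) _)
  rw [← lintegral_add_left hm1, ← lintegral_add_right _ (hm1.fun_add hm2)]
  refine lintegral_congr fun x => ?_
  rw [lintegral_add_right _ ((hx1 x).fun_add (hx2 x)), lintegral_add_left (hx1 x)]

/-! ### Thin layers along a Lipschitz boundary -/

/-- The layer `{0 < g < τ}` has measure `O(τ)` when `g` grows at unit speed in a direction `e`:
about `1 / τ` of its translates are disjoint and stay in a bounded region. -/
lemma volume_layer_le {g : EuclideanSpace ℝ (Fin N) → ℝ} (hg : Measurable g)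
    {e : EuclideanSpace ℝ (Fin N)} (he : ‖e‖ = 1) (hge : ∀ x (t : ℝ), g (x - t • e) = g x - t)
    (x₀ : EuclideanSpace ℝ (Fin N)) (r : ℝ) {τ : ℝ} (hτ : 0 < τ) (hτ' : τ ≤ 1 / 2) :
    volume (Metric.ball x₀ r ∩ g ⁻¹' Ioo 0 τ) ≤
      ENNReal.ofReal (2 * τ) * volume (Metric.ball x₀ (r + 1)) := by
  set S := Metric.ball x₀ r ∩ g ⁻¹' Ioo 0 τ with hS
  have hSm : MeasurableSet S := measurableSet_ball.inter (hg measurableSet_Ioo)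
  set n := ⌊1 / τ⌋₊ with hn
  have hn1 : (n : ℝ) * τ ≤ 1 := by
    have := Nat.floor_le (one_div_pos.2 hτ).le
    rwa [le_div_iff₀ hτ] at this
  -- From `n > 1/τ - 1` one gets `n τ > 1 - τ ≥ 1/2`.
  have hn2 : 1 ≤ 2 * τ * n := by
    have := Nat.lt_floor_add_one (1 / τ)
    rw [div_lt_iff₀ hτ] at this
    nlinarith
  let T : ℕ → Set (EuclideanSpace ℝ (Fin N)) := fun k => (fun x => x - ((k : ℝ) * τ) • e) ⁻¹' S
  have hT : ∀ k, volume (T k) = volume S := fun k =>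
    (measurePreserving_sub_right volume _).measure_preimage hSm.nullMeasurableSet
  have hTm : ∀ k, MeasurableSet (T k) := fun k => hSm.preimage (by fun_prop)
  -- On `T k` the function `g` takes values in `(kτ, (k+1)τ)`, and these intervals are disjoint.
  have hTd : Pairwise (Function.onFun Disjoint T) := by
    intro i j hij
    refine disjoint_left.2 fun x hi hj => ?_
    have h1 : g (x - ((i : ℝ) * τ) • e) ∈ Ioo 0 τ := hi.2
    have h2 : g (x - ((j : ℝ) * τ) • e) ∈ Ioo 0 τ := hj.2
    rw [hge] at h1 h2
    rcases lt_or_gt_of_ne hij with h | h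
    · have : (i : ℝ) + 1 ≤ j := by exact_mod_cast h
      nlinarith [h1.1, h1.2, h2.1, h2.2]
    · have : (j : ℝ) + 1 ≤ i := by exact_mod_cast h
      nlinarith [h1.1, h1.2, h2.1, h2.2]
  have hTsub : (⋃ k ∈ Finset.range n, T k) ⊆ Metric.ball x₀ (r + 1) := by
    refine iUnion₂_subset fun k hk x hx => ?_
    have hx1 : dist (x - ((k : ℝ) * τ) • e) x₀ < r := hx.1
    have hkn : (k : ℝ) ≤ n := by exact_mod_cast (Finset.mem_range.1 hk).le
    have hd : dist x (x - ((k : ℝ) * τ) • e) ≤ 1 := by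
      rw [dist_eq_norm, sub_sub_cancel, norm_smul, he, mul_one, Real.norm_eq_abs,
        abs_of_nonneg (by positivity)]
      nlinarith
    rw [Metric.mem_ball]
    linarith [dist_triangle x (x - ((k : ℝ) * τ) • e) x₀]
  have hsum : (n : ℝ≥0∞) * volume S ≤ volume (Metric.ball x₀ (r + 1)) := by
    calc (n : ℝ≥0∞) * volume S = ∑ k ∈ Finset.range n, volume (T k) := by simp [hT]
      _ = volume (⋃ k ∈ Finset.range n, T k) :=
        (measure_biUnion_finset (fun i _ j _ hij => hTd hij) fun k _ => hTm k).symm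
      _ ≤ _ := measure_mono hTsub
  calc volume S ≤ ENNReal.ofReal (2 * τ * n) * volume S :=
        le_mul_of_one_le_left' (by rwa [ENNReal.one_le_ofReal])
    _ = ENNReal.ofReal (2 * τ) * (n * volume S) := by
        rw [ENNReal.ofReal_mul (by positivity), ENNReal.ofReal_natCast, mul_assoc]
    _ ≤ _ := by gcongr

/-- The part of `Ω` within distance `δ` of the set `A` has measure `O(δ)`. -/
def HasThinLayer (Ω A : Set (EuclideanSpace ℝ (Fin N))) : Prop :=
  ∃ C : ℝ≥0∞, C ≠ ⊤ ∧ ∃ δ₀ : ℝ, 0 < δ₀ ∧ ∀ δ : ℝ, 0 < δ → δ < δ₀ →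
    volume (Ω ∩ Metric.thickening δ A) ≤ C * ENNReal.ofReal δ

lemma HasThinLayer.mono {A B : Set (EuclideanSpace ℝ (Fin N))} (hAB : A ⊆ B)
    (h : HasThinLayer Ω B) : HasThinLayer Ω A := by
  obtain ⟨C, hC, δ₀, hδ₀, h⟩ := h
  exact ⟨C, hC, δ₀, hδ₀, fun δ h1 h2 => (measure_mono (inter_subset_inter_right _
    (Metric.thickening_subset_of_subset δ hAB))).trans (h δ h1 h2)⟩

lemma HasThinLayer.union {A B : Set (EuclideanSpace ℝ (Fin N))} (hA : HasThinLayer Ω A)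
    (hB : HasThinLayer Ω B) : HasThinLayer Ω (A ∪ B) := by
  obtain ⟨C, hC, δ₀, hδ₀, hA⟩ := hA
  obtain ⟨D, hD, δ₁, hδ₁, hB⟩ := hB
  refine ⟨C + D, ENNReal.add_ne_top.2 ⟨hC, hD⟩, min δ₀ δ₁, lt_min hδ₀ hδ₁, fun δ h1 h2 => ?_⟩
  rw [Metric.thickening_union, inter_union_distrib_left, add_mul]
  exact (measure_union_le _ _).trans (add_le_add (hA δ h1 (h2.trans_le (min_le_left _ _)))
    (hB δ h1 (h2.trans_le (min_le_right _ _))))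

/-- The height above the graph, `g`, is positive on `Ω` and nonpositive at frontier points inside
the chart. Being `(K + 1)`-Lipschitz, it is below `(K + 1)δ` at points within `δ` of them, so the
layer is covered by `volume_layer_le`. -/
lemma HasLipschitzBoundary.hasThinLayer_ball (hΩ : IsOpen Ω) (h : HasLipschitzBoundary Ω)
    {x : EuclideanSpace ℝ (Fin N)} (hx : x ∈ frontier Ω) :
    ∃ r > 0, HasThinLayer Ω (frontier Ω ∩ Metric.ball x r) := by
  obtain ⟨r, e, K, γ, hr, he, hγ, hepi⟩ := h x hx
  set P := (Submodule.span ℝ {e})ᗮ.orthogonalProjectionOnto with hP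
  set g : EuclideanSpace ℝ (Fin N) → ℝ := fun y => inner ℝ e y - γ (P y) with hg
  have hgc : Continuous g := by
    have h1 : Continuous fun y => γ (P y) := hγ.continuous.comp P.continuous
    exact (continuous_const.inner continuous_id).sub h1
  have hPe : P e = 0 := Submodule.orthogonalProjectionOnto_orthogonalComplement_singleton_eq_zero e
  have hge : ∀ y (t : ℝ), g (y - t • e) = g y - t := by
    intro y t
    simp only [hg, map_sub, map_smul, hPe, smul_zero, sub_zero, inner_sub_right, inner_smul_right,
      real_inner_self_eq_norm_sq, he]
    ring
  set M : ℝ := K + 1 with hM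
  have hM0 : 0 < M := by positivity
  -- Halving the radius, with `δ < r / 2`, keeps points near the smaller ball in the chart; `δ < 1 /
  -- (2M)` provides the bound `τ ≤ 1/2` for `τ = Mδ`.
  refine ⟨r / 2, half_pos hr, ENNReal.ofReal (2 * M) * volume (Metric.ball x (r + 1)),
    ENNReal.mul_ne_top ENNReal.ofReal_ne_top measure_ball_lt_top.ne, min (r / 2) (1 / (2 * M)),
    by positivity, fun δ hδ hδ' => ?_⟩
  have hδr : δ < r / 2 := hδ'.trans_le (min_le_left _ _)
  have hδM : M * δ ≤ 1 / 2 := by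
    have := (hδ'.trans_le (min_le_right _ _)).le
    rw [le_div_iff₀ (by positivity)] at this
    linarith
  have hsub : Ω ∩ Metric.thickening δ (frontier Ω ∩ Metric.ball x (r / 2)) ⊆
      Metric.ball x r ∩ g ⁻¹' Ioo 0 (M * δ) := by
    rintro y ⟨hyΩ, hy⟩
    obtain ⟨z, ⟨hzf, hzx⟩, hyz⟩ := Metric.mem_thickening_iff.1 hy
    rw [Metric.mem_ball] at hzx
    have hyx : y ∈ Metric.ball x r := by
      rw [Metric.mem_ball]
      linarith [dist_triangle y z x]
    have hzx' : z ∈ Metric.ball x r := by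
      rw [Metric.mem_ball]
      linarith
    have hzΩ : z ∉ Ω := by
      rw [hΩ.frontier_eq] at hzf
      exact hzf.2
    have h1 : γ (P y) < inner ℝ e y := (hepi y hyx).1 hyΩ
    have h2 : inner ℝ e z ≤ γ (P z) := not_lt.1 fun h => hzΩ ((hepi z hzx').2 h)
    have h3 : inner ℝ e y - inner ℝ e z ≤ dist y z := by
      rw [← inner_sub_right, dist_eq_norm]
      simpa [he] using real_inner_le_norm e (y - z)
    have h4 : |γ (P z) - γ (P y)| ≤ K * dist y z := by
      rw [← Real.dist_eq]
      refine (hγ.dist_le_mul _ _).trans (mul_le_mul_of_nonneg_left ?_ K.2)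
      rw [dist_eq_norm, ← map_sub, dist_comm, dist_eq_norm]
      exact Submodule.norm_orthogonalProjectionOnto_apply_le _ _
    refine ⟨hyx, sub_pos.2 h1, ?_⟩
    have h5 := (abs_le.1 h4).2
    have h6 : M * dist y z < M * δ := mul_lt_mul_of_pos_left hyz hM0
    simp only [hg]
    rw [hM] at h6 ⊢
    linarith
  refine (measure_mono hsub).trans
    ((volume_layer_le hgc.measurable he hge x r (by positivity) hδM).trans (le_of_eq ?_))
  rw [← mul_assoc, ENNReal.ofReal_mul (by positivity), mul_right_comm]

lemma HasLipschitzBoundary.hasThinLayer (hΩ : IsOpen Ω) (hΩb : Bornology.IsBounded Ω)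
    (h : HasLipschitzBoundary Ω) : HasThinLayer Ω (frontier Ω) := by
  have hK : IsCompact (frontier Ω) :=
    hΩb.isCompact_closure.of_isClosed_subset isClosed_frontier frontier_subset_closure
  refine hK.induction_on (p := HasThinLayer Ω) ⟨0, by simp, 1, one_pos, fun δ _ _ => by simp⟩
    (fun A B => HasThinLayer.mono) (fun A B => HasThinLayer.union) fun x hx => ?_
  obtain ⟨r, hr, hl⟩ := h.hasThinLayer_ball hΩ hx
  exact ⟨_, inter_mem_nhdsWithin _ (Metric.ball_mem_nhds x hr), hl⟩

/-! ### Cutting off near the frontier and passing to the limit -/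

/-- The cut-off vanishing at distance at most `δ` from the frontier of `Ω`, and equal to `1` at
distance at least `2δ`. -/
noncomputable def frontierCutoff (Ω : Set (EuclideanSpace ℝ (Fin N))) (δ : ℝ)
    (x : EuclideanSpace ℝ (Fin N)) : ℝ :=
  max 0 (min 1 (Metric.infDist x (frontier Ω) / δ - 1))

lemma continuous_frontierCutoff (δ : ℝ) : Continuous (frontierCutoff Ω δ) := by
  have := Metric.continuous_infDist_pt (frontier Ω)
  unfold frontierCutoff
  fun_prop

lemma frontierCutoff_nonneg (δ : ℝ) (x : EuclideanSpace ℝ (Fin N)) : 0 ≤ frontierCutoff Ω δ x :=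
  le_max_left _ _

lemma frontierCutoff_le_one (δ : ℝ) (x : EuclideanSpace ℝ (Fin N)) : frontierCutoff Ω δ x ≤ 1 :=
  max_le zero_le_one (min_le_left _ _)

lemma abs_frontierCutoff_sub_le {δ : ℝ} (hδ : 0 < δ) (x y : EuclideanSpace ℝ (Fin N)) :
    |frontierCutoff Ω δ x - frontierCutoff Ω δ y| ≤ ‖x - y‖ / δ := by
  have h : |Metric.infDist x (frontier Ω) / δ - Metric.infDist y (frontier Ω) / δ| ≤
      ‖x - y‖ / δ := by
    rw [← sub_div, abs_div, abs_of_pos hδ, ← Real.dist_eq, ← dist_eq_norm]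
    gcongr
    simpa using (Metric.lipschitz_infDist_pt (frontier Ω)).dist_le_mul x y
  refine le_trans ?_ h
  unfold frontierCutoff
  refine (abs_max_sub_max_le_max _ _ _ _).trans (max_le (by simp) ?_)
  refine (abs_min_sub_min_le_max _ _ _ _).trans (max_le (by simp) ?_)
  rw [sub_sub_sub_cancel_right]

lemma frontierCutoff_eq_one {δ : ℝ} (hδ : 0 < δ) {x : EuclideanSpace ℝ (Fin N)}
    (hne : (frontier Ω).Nonempty) (hx : x ∉ Metric.thickening (2 * δ) (frontier Ω)) :
    frontierCutoff Ω δ x = 1 := by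
  rw [Metric.mem_thickening_iff_infDist_lt hne, not_lt, ← le_div_iff₀ hδ] at hx
  unfold frontierCutoff
  grind

lemma le_infDist_of_frontierCutoff_ne_zero {δ : ℝ} (hδ : 0 < δ) {x : EuclideanSpace ℝ (Fin N)}
    (hx : frontierCutoff Ω δ x ≠ 0) : δ ≤ Metric.infDist x (frontier Ω) := by
  by_contra! h
  rw [← div_lt_one hδ] at h
  refine hx ?_
  unfold frontierCutoff
  grind

lemma isCompact_closure_inter_le_infDist (hΩb : Bornology.IsBounded Ω) (δ : ℝ) :
    IsCompact (closure Ω ∩ {x | δ ≤ Metric.infDist x (frontier Ω)}) :=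
  hΩb.isCompact_closure.inter_right
    (isClosed_le continuous_const (Metric.continuous_infDist_pt _))

lemma closure_inter_le_infDist_subset (hΩ : IsOpen Ω) {δ : ℝ} (hδ : 0 < δ) :
    closure Ω ∩ {x | δ ≤ Metric.infDist x (frontier Ω)} ⊆ Ω := by
  rintro x ⟨hx, hd : δ ≤ _⟩
  by_contra hn
  have : x ∈ frontier Ω := hΩ.frontier_eq ▸ ⟨hx, hn⟩
  rw [Metric.infDist_zero_of_mem this] at hd
  exact hδ.not_ge hd

/-- The competitor is `A.indicator η`: it equals 1 on `A` off the layer, hence the lower bound on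
its integral, and its support stays at distance at least `δ` from the frontier, so mollification
applies. -/
lemma firstEigenvalue_mul_volume_sub_le (hΩ : IsOpen Ω) (hΩb : Bornology.IsBounded Ω)
    (hne : (frontier Ω).Nonempty) {A : Set (EuclideanSpace ℝ (Fin N))} (hA : MeasurableSet A)
    (hAΩ : A ⊆ Ω) {δ : ℝ} (hδ : 0 < δ) {B : ℝ≥0∞}
    (hB : ∀ x : EuclideanSpace ℝ (Fin N), ∫⁻ y, truncatedKernel s δ x y ≤ B) :
    firstEigenvalue s Ω *
        (volume A - volume (Ω ∩ Metric.thickening (2 * δ) (frontier Ω))) ≤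
      perimeter s A + 2 * (volume (Ω ∩ Metric.thickening (2 * δ) (frontier Ω)) * B) := by
  set L := Ω ∩ Metric.thickening (2 * δ) (frontier Ω) with hL
  set η := frontierCutoff Ω δ with hη
  have hLm : MeasurableSet L := (hΩ.inter Metric.isOpen_thickening).measurableSet
  have hηL : ∀ x ∈ A, x ∉ L → η x = 1 := fun x hx hxL =>
    frontierCutoff_eq_one hδ hne fun h => hxL ⟨hAΩ hx, h⟩
  have hm : Measurable (A.indicator η) := (continuous_frontierCutoff δ).measurable.indicator hA
  have hint : Integrable (A.indicator η) := by
    have hfin : volume A ≠ ⊤ := (hΩb.subset hAΩ).measure_lt_top.ne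
    have h1 : Integrable (A.indicator fun _ => (1 : ℝ)) :=
      (integrableOn_const hfin).integrable_indicator hA
    refine h1.mono' hm.aestronglyMeasurable (Filter.Eventually.of_forall fun x => ?_)
    by_cases hx : x ∈ A
    · simpa [hx, abs_of_nonneg (frontierCutoff_nonneg δ x), hη] using frontierCutoff_le_one δ x
    · simp [hx]
  have hsupp : Function.support (A.indicator η) ⊆
      closure Ω ∩ {x | δ ≤ Metric.infDist x (frontier Ω)} := by
    intro x hx
    rw [support_indicator] at hx
    exact ⟨subset_closure (hAΩ hx.1), le_infDist_of_frontierCutoff_ne_zero hδ hx.2⟩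
  have hvol : volume A - volume L ≤ ∫⁻ x, ENNReal.ofReal (A.indicator η x) := by
    refine (le_measure_sdiff).trans ?_
    rw [← lintegral_indicator_one (hA.diff hLm)]
    refine lintegral_mono fun x => ?_
    by_cases hx : x ∈ A \ L
    · simp [hx.1, hx.2, hηL x hx.1 hx.2]
    · simp [hx]
  calc _ ≤ firstEigenvalue s Ω * ∫⁻ x, ENNReal.ofReal (A.indicator η x) := by gcongr
    _ ≤ gagliardo s (A.indicator η) :=
        firstEigenvalue_mul_le hΩ hm hint
          (fun x => indicator_nonneg (fun x _ => frontierCutoff_nonneg δ x) x)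
          (isCompact_closure_inter_le_infDist hΩb δ) (closure_inter_le_infDist_subset hΩ hδ) hsupp
    _ ≤ _ := gagliardo_indicator_cutoff_le hLm (frontierCutoff_nonneg δ)
        (frontierCutoff_le_one δ) (abs_frontierCutoff_sub_le hδ) hηL hB

open Filter Topology in
lemma firstEigenvalue_mul_volume_le_perimeter (hN : 1 ≤ N) (hs : s ∈ Ioo (0 : ℝ) 1)
    (hΩ : IsOpen Ω) (hΩb : Bornology.IsBounded Ω) (hne : (frontier Ω).Nonempty)
    (hthin : HasThinLayer Ω (frontier Ω))
    {A : Set (EuclideanSpace ℝ (Fin N))} (hA : MeasurableSet A)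
    (hAΩ : A ⊆ Ω) (hA0 : volume A ≠ 0) :
    firstEigenvalue s Ω * volume A ≤ perimeter s A := by
  obtain ⟨C, hC, hker⟩ := exists_lintegral_truncated_kernel_le (N := N) hN hs
  obtain ⟨D, hD, δ₀, hδ₀, hlayer⟩ := hthin
  -- The layer has width `2δ`, which supplies a second factor 2 and turns the constant 2 of the
  -- cut-off estimate into 4.
  have hev : ∀ᶠ δ : ℝ in 𝓝[>] 0, firstEigenvalue s Ω * (volume A - D * ENNReal.ofReal (2 * δ)) ≤
      perimeter s A + 4 * (D * C) * ENNReal.ofReal (δ ^ (1 - s)) := by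
    filter_upwards [Ioo_mem_nhdsGT (half_pos hδ₀)] with δ hδ
    have hl := hlayer (2 * δ) (by linarith [hδ.1]) (by linarith [hδ.2])
    calc _ ≤ firstEigenvalue s Ω *
        (volume A - volume (Ω ∩ Metric.thickening (2 * δ) (frontier Ω))) := by gcongr
      _ ≤ _ := firstEigenvalue_mul_volume_sub_le hΩ hΩb hne hA hAΩ hδ.1 (hker δ hδ.1)
      _ ≤ perimeter s A +
          2 * ((D * ENNReal.ofReal (2 * δ)) * (C * ENNReal.ofReal (δ ^ (-s)))) := by gcongr
      _ = _ := by
        have h : δ ^ (1 - s) = δ * δ ^ (-s) := by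
          rw [sub_eq_add_neg, Real.rpow_add hδ.1, Real.rpow_one]
        rw [h, ENNReal.ofReal_mul hδ.1.le, ENNReal.ofReal_mul zero_le_two, ENNReal.ofReal_ofNat]
        ring
  have h1 : Tendsto (fun δ : ℝ => volume A - D * ENNReal.ofReal (2 * δ)) (𝓝[>] 0)
      (𝓝 (volume A)) := by
    have h : Tendsto (fun δ : ℝ => D * ENNReal.ofReal (2 * δ)) (𝓝[>] 0) (𝓝 0) := by
      have h2 : Continuous fun δ : ℝ => ENNReal.ofReal (2 * δ) :=
        ENNReal.continuous_ofReal.comp (continuous_const_mul 2)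
      have := ENNReal.Tendsto.const_mul (a := D)
        ((h2.tendsto' 0 0 (by simp)).mono_left (nhdsWithin_le_nhds (s := Ioi 0))) (.inr hD)
      rwa [mul_zero] at this
    have := ENNReal.Tendsto.sub (tendsto_const_nhds (x := volume A)) h (.inr ENNReal.zero_ne_top)
    rwa [tsub_zero] at this
  have h2 : Tendsto (fun δ : ℝ => perimeter s A + 4 * (D * C) * ENNReal.ofReal (δ ^ (1 - s)))
      (𝓝[>] 0) (𝓝 (perimeter s A)) := by
    have hs' : 0 < 1 - s := by linarith [hs.2]
    have h : Continuous fun δ : ℝ => ENNReal.ofReal (δ ^ (1 - s)) :=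
      ENNReal.continuous_ofReal.comp (Real.continuous_rpow_const hs'.le)
    have h3 := ENNReal.Tendsto.const_mul (a := 4 * (D * C))
      ((h.tendsto' 0 0 (by simp [Real.zero_rpow hs'.ne'])).mono_left (nhdsWithin_le_nhds (s := Ioi 0)))
      (.inr (ENNReal.mul_ne_top (by simp) (ENNReal.mul_ne_top hD hC)))
    have := h3.const_add (perimeter s A)
    rwa [mul_zero, add_zero] at this
  -- `firstEigenvalue s Ω` is not yet known to be finite; multiplication by `⊤` is continuous at
  -- `volume A` because that limit is nonzero.
  exact le_of_tendsto_of_tendsto (ENNReal.Tendsto.const_mul h1 (.inl hA0)) h2 hev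

lemma cheegerConstant_le_firstEigenvalue (hΩ : MeasurableSet Ω) (hΩ' : volume Ω ≠ ⊤) :
    cheegerConstant s Ω ≤ firstEigenvalue s Ω := by
  refine le_iInf₂ fun u ⟨hu, hu1, _⟩ => ?_
  simpa [hu1] using hu.1.cheegerConstant_mul_eLpNorm_le hΩ hΩ'

lemma firstEigenvalue_le_cheegerConstant (hN : 1 ≤ N) (hs : s ∈ Ioo (0 : ℝ) 1)
    (hΩ : IsOpen Ω) (hΩb : Bornology.IsBounded Ω) (hlip : HasLipschitzBoundary Ω) :
    firstEigenvalue s Ω ≤ cheegerConstant s Ω := by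
  refine le_iInf₂ fun E ⟨hEΩ, hEm, hE0⟩ => ?_
  obtain ⟨A, hAE, hA, hAe⟩ := hEm.exists_measurable_subset_ae_eq
  have hE' : volume E ≠ ⊤ := (hΩb.subset hEΩ).measure_lt_top.ne
  -- `Metric.infDist` to the empty set is 0 by convention, which would make the cut-off vanish
  -- identically. A nonempty bounded set is not the whole space when `N ≥ 1`, so its frontier is
  -- nonempty.
  have hne : (frontier Ω).Nonempty := by
    rw [nonempty_frontier_iff]
    refine ⟨(nonempty_of_measure_ne_zero hE0).mono hEΩ, ?_⟩
    rintro rfl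
    have : Nontrivial (EuclideanSpace ℝ (Fin N)) :=
      Module.nontrivial_of_finrank_pos (R := ℝ) (by rw [finrank_euclideanSpace_fin]; omega)
    exact NormedSpace.unbounded_univ ℝ (EuclideanSpace ℝ (Fin N)) hΩb
  rw [ENNReal.le_div_iff_mul_le (.inl hE0) (.inl hE'), ← perimeter_congr_ae hAe,
    ← measure_congr hAe]
  exact firstEigenvalue_mul_volume_le_perimeter hN hs hΩ hΩb hne (hlip.hasThinLayer hΩ hΩb) hA
    (hAE.trans hEΩ) (by rwa [measure_congr hAe])

end FractionalCheeger

theorem mainTheorem1 (N : ℕ) (hN : 1 ≤ N) (s : ℝ) (hs : s ∈ Set.Ioo (0 : ℝ) 1)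
    (Ω : Set (EuclideanSpace ℝ (Fin N))) (hΩ : IsOpen Ω) (hΩb : Bornology.IsBounded Ω) :
    (∀ u : EuclideanSpace ℝ (Fin N) → ℝ, FractionalCheeger.MemCalW s Ω u →
      ¬ (∀ᵐ x ∂volume, u x = 0) →
        FractionalCheeger.cheegerConstant s Ω ≤
            FractionalCheeger.gagliardo s u / eLpNorm u 1 (volume.restrict Ω) ∧
        (FractionalCheeger.gagliardo s u / eLpNorm u 1 (volume.restrict Ω) =
            FractionalCheeger.cheegerConstant s Ω →
          ∀ᵐ t : ℝ ∂volume, 0 < t →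
            (volume {x ∈ Ω | t < |u x|} ≠ 0 →
              FractionalCheeger.IsCheegerSet s Ω {x ∈ Ω | t < |u x|}) ∧
            (volume {x ∈ Ω | t < u x} ≠ 0 →
              FractionalCheeger.IsCheegerSet s Ω {x ∈ Ω | t < u x}) ∧
            (volume {x ∈ Ω | u x < -t} ≠ 0 →
              FractionalCheeger.IsCheegerSet s Ω {x ∈ Ω | u x < -t}))) ∧
    (FractionalCheeger.HasLipschitzBoundary Ω →
      FractionalCheeger.firstEigenvalue s Ω = FractionalCheeger.cheegerConstant s Ω) := by
  have hΩm := hΩ.measurableSet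
  have hΩ' : volume Ω ≠ ⊤ := hΩb.measure_lt_top.ne
  refine ⟨fun u hu h0 => ⟨?_, fun heq => ?_⟩, fun hlip => le_antisymm
    (FractionalCheeger.firstEigenvalue_le_cheegerConstant hN hs hΩ hΩb hlip)
    (FractionalCheeger.cheegerConstant_le_firstEigenvalue hΩm hΩ')⟩
  · rw [ENNReal.le_div_iff_mul_le (.inl (hu.eLpNorm_ne_zero hΩm h0)) (.inl hu.eLpNorm_ne_top)]
    exact hu.cheegerConstant_mul_eLpNorm_le hΩm hΩ'
  · refine hu.ae_isCheegerSet_of_eq hΩm hΩ' ?_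
    rw [← heq, ENNReal.div_mul_cancel (hu.eLpNorm_ne_zero hΩm h0) hu.eLpNorm_ne_top]
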